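/- Let $D=(0,1)$, and let $X=H^2(D)\times L^2(D)$ (complex-valued functions) be the Hilbert space with $\langle \boldsymbol u,\boldsymbol\phi\rangle_X=\langle u_1,\phi_1\rangle_{L^2}+\langle u_1'',\phi_1''\rangle_{L^2}+\langle u_2,\phi_2\rangle_{L^2}$ for $\boldsymbol u=(u_1,u_2)$, $\boldsymbol\phi=(\phi_1,\phi_2)$ (inner products are linear in the first argument). Let $\chi_1,\chi_2\in L^\infty(D)$ be real valued with $\chi_2>0$ a.e. in $D$, put $M=\|\chi_1\|_{L^\infty}+\|\chi_2\|_{L^\infty}$, and let $q\in C^1[0,1]$ be real valued with $Q=\|q\|_{L^\infty}>0$. For $\omega\in\mathbb C$ let $T_\omega:X\to X$ be the nonlinear map given, through the Riesz representation theorem, by $$\langle T_\omega(\boldsymbol u),\boldsymbol\phi\rangle_X=\int_D\big[(u_1''+\omega^2qu_1)\overline{\phi}_2+\omega^2\chi_1u_2\overline{u}_1\overline{\phi}_2\big]dx+\int_D\big[u_2(\overline{\phi}_1''+4\omega^2q\overline{\phi}_1)+\omega^2\chi_2u_1^2\overline{\phi}_1\big]dx\qquad\text{for all }\boldsymbol\phi\in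 X.$$ The equation $T_\omega(\boldsymbol u)=0$ is the weak form of $u_1''+\omega^2qu_1=-\omega^2\chi_1u_2\overline{u}_1$, $u_2''+4\omega^2qu_2=-\omega^2\chi_2u_1^2$ in $D$, $u_2=u_2'=0$ at $\partial D$. There exists a constant $c_Q(\chi_2)>0$, depending only on $Q$ and $\chi_2$, such that $T_\omega(\boldsymbol u)\neq0$ whenever $$0\neq\boldsymbol u\in X\quad\text{and}\quad 0<|\omega|^2\le\frac{c_Q(\chi_2)}{M(1+M\|\boldsymbol u\|_X)}.$$ Consequently, there are constants $\delta,c>0$, depending only on $Q$, $\chi_2$ and $M$, such that if $0<|\omega|\le\delta$, $\boldsymbol u\neq0$ and $T_\omega(\boldsymbol u)=0$, then $\|\boldsymbol u\|_X\ge c/|\omega|^2$. -/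

import Mathlib

namespace SHG

open MeasureTheory Set
open scoped ComplexConjugate ENNReal

noncomputable section

/-- Lebesgue measure on `D = (0,1)`. -/
abbrev μD : Measure ℝ := volume.restrict (Ioo (0 : ℝ) 1)

/-- The complex Hilbert space `L²(0,1)`. -/
abbrev L2 : Type := Lp ℂ 2 μD

/-- The real space `L^∞(0,1)` with the essential supremum norm. -/
abbrev Linf : Type := Lp ℝ ∞ μD

/-- Test functions: smooth with compact support inside `(0,1)`. -/
structure IsTest (φ : ℝ → ℝ) : Prop where
  contDiff : ContDiff ℝ (⊤ : ℕ∞) φ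
  hasCompactSupport : HasCompactSupport φ
  tsupport_subset : tsupport φ ⊆ Ioo (0 : ℝ) 1

/-- `g` is the weak derivative of `f` on `(0,1)`. -/
def IsWeakDeriv (f g : L2) : Prop :=
  ∀ φ : ℝ → ℝ, IsTest φ → ∫ x, deriv φ x • f x ∂μD = - ∫ x, φ x • g x ∂μD

lemma IsTest.isTest_deriv {φ : ℝ → ℝ} (h : IsTest φ) : IsTest (deriv φ) where
  contDiff := (contDiff_infty_iff_deriv.1 h.contDiff).2
  hasCompactSupport := h.hasCompactSupport.deriv
  tsupport_subset := (closure_minimal (support_deriv_subset) isClosed_closure).trans h.tsupport_subset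

lemma IsTest.bound {φ : ℝ → ℝ} (h : IsTest φ) : ∃ C, ∀ x, ‖φ x‖ ≤ C :=
  h.contDiff.continuous.bounded_above_of_compact_support h.hasCompactSupport

lemma integrable_L2 (f : L2) : Integrable f μD := (Lp.memLp f).integrable (by norm_num)

lemma IsTest.integrable_smul {φ : ℝ → ℝ} (h : IsTest φ) {f : ℝ → ℂ} (hf : Integrable f μD) :
    Integrable (fun x => φ x • f x) μD := by
  obtain ⟨C, hC⟩ := h.bound
  exact hf.bdd_smul C h.contDiff.continuous.aestronglyMeasurable (Filter.Eventually.of_forall hC)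

/-- The primitive of `v` vanishing at `0`. -/
def prim (v : ℝ → ℂ) (x : ℝ) : ℂ := ∫ t, (Iio x).indicator v t ∂μD

lemma norm_prim_le (v : L2) (x : ℝ) : ‖prim v x‖ ≤ ‖v‖ := by
  have h1 : ‖prim v x‖ ≤ ∫ t, ‖v t‖ ∂μD := by
    refine (norm_integral_le_integral_norm _).trans ?_
    refine integral_mono_of_nonneg (Filter.Eventually.of_forall fun _ => norm_nonneg _)
      (integrable_L2 v).norm (Filter.Eventually.of_forall fun t => ?_)
    exact norm_indicator_le_norm_self _ _
  refine h1.trans ?_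
  have : IsProbabilityMeasure μD := ⟨by simp⟩
  have h2 : eLpNorm v 1 μD ≤ eLpNorm v 2 μD :=
    eLpNorm_le_eLpNorm_of_exponent_le (by norm_num) (Lp.aestronglyMeasurable v)
  rw [Lp.norm_def, integral_norm_eq_lintegral_enorm (Lp.aestronglyMeasurable v),
    ← eLpNorm_one_eq_lintegral_enorm]
  exact ENNReal.toReal_mono (Lp.eLpNorm_ne_top v) h2

lemma integrable_kernel {ψ : ℝ → ℝ} (hψ : Continuous ψ) (C : ℝ) (hC : ∀ x, ‖ψ x‖ ≤ C)
    {v : ℝ → ℂ} (hv : Integrable v μD) :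
    Integrable (fun z : ℝ × ℝ => ψ z.1 • (Iio z.1).indicator v z.2) (μD.prod μD) := by
  have h1 : Integrable (fun z : ℝ × ℝ => v z.2) (μD.prod μD) := hv.comp_snd _
  have h2 : MeasurableSet {z : ℝ × ℝ | z.2 < z.1} := measurableSet_lt measurable_snd measurable_fst
  have h3 := Integrable.bdd_smul (φ := fun z : ℝ × ℝ => ψ z.1) (h1.indicator h2) C
    (hψ.comp continuous_fst).aestronglyMeasurable (Filter.Eventually.of_forall fun z => hC _)
  refine h3.congr (Filter.Eventually.of_forall fun z => ?_)
  simp [Set.indicator]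

lemma integrable_prim {v : ℝ → ℂ} (hv : Integrable v μD) : Integrable (prim v) μD := by
  have := (integrable_kernel (ψ := fun _ => 1) continuous_const 1 (by simp) hv).integral_prod_left
  simp only [one_smul] at this
  exact this

/-- The integral of the primitive of a function against the derivative of a test function. -/
lemma integral_deriv_smul_prim {φ : ℝ → ℝ} (hφ : IsTest φ) {v : ℝ → ℂ} (hv : Integrable v μD) :
    ∫ x, deriv φ x • prim v x ∂μD = - ∫ x, φ x • v x ∂μD := by
  obtain ⟨C, hC⟩ := hφ.isTest_deriv.bound
  have hI := integrable_kernel hφ.isTest_deriv.contDiff.continuous C hC hv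
  have e1 : ∀ x, deriv φ x • prim v x = ∫ t, deriv φ x • (Iio x).indicator v t ∂μD := fun x => by
    rw [prim, integral_smul]
  simp_rw [e1]
  rw [integral_integral_swap hI, ← integral_neg]
  refine setIntegral_congr_fun measurableSet_Ioo fun t ht => ?_
  have e2 : ∀ x, deriv φ x • (Iio x).indicator v t = ((Ioi t).indicator (deriv φ) x) • v t := by
    intro x; by_cases h : t < x <;> simp [Set.indicator, h]
  simp_rw [e2]
  rw [integral_smul_const, integral_indicator measurableSet_Ioi,
    Measure.restrict_restrict measurableSet_Ioi]
  have e3 : Ioi t ∩ Ioo 0 1 = Ioo t 1 := by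
    ext x; simp only [mem_inter_iff, mem_Ioi, mem_Ioo]
    constructor
    · rintro ⟨h, -, h'⟩; exact ⟨h, h'⟩
    · rintro ⟨h, h'⟩; exact ⟨h, ht.1.trans h, h'⟩
  rw [e3, ← integral_Ioc_eq_integral_Ioo, ← intervalIntegral.integral_of_le ht.2.le,
    intervalIntegral.integral_deriv_eq_sub
      (fun x _ => (hφ.contDiff.differentiable (by simp)).differentiableAt)
      (hφ.isTest_deriv.contDiff.continuous.intervalIntegrable _ _)]
  have : φ 1 = 0 := by
    by_contra h
    exact absurd (hφ.tsupport_subset (subset_tsupport _ (Function.mem_support.2 h))).2 (lt_irrefl _)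
  simp [this]

lemma IsTest.eq_zero {φ : ℝ → ℝ} (hφ : IsTest φ) {x : ℝ} (hx : x ∉ Ioo (0:ℝ) 1) : φ x = 0 := by
  by_contra h
  exact hx (hφ.tsupport_subset (subset_tsupport _ (Function.mem_support.2 h)))

lemma IsTest.exists_primitive {η : ℝ → ℝ} (hη : IsTest η) (h0 : ∫ x, η x ∂μD = 0) :
    ∃ φ, IsTest φ ∧ deriv φ = η := by
  have hc := hη.contDiff.continuous
  have hd : ∀ x, HasDerivAt (fun x => ∫ t in (0:ℝ)..x, η t) (η x) x := fun x =>
    intervalIntegral.integral_hasDerivAt_right (hc.intervalIntegrable _ _)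
      (hc.stronglyMeasurableAtFilter _ _) hc.continuousAt
  have hde : deriv (fun x => ∫ t in (0:ℝ)..x, η t) = η := funext fun x => (hd x).deriv
  have h01 : ∫ t in (0:ℝ)..1, η t = 0 := by
    rw [intervalIntegral.integral_of_le zero_le_one, integral_Ioc_eq_integral_Ioo]; exact h0
  obtain ⟨a, b, ha, hb, hab⟩ : ∃ a b : ℝ, 0 < a ∧ b < 1 ∧ ∀ x, x ∉ Icc a b → η x = 0 := by
    rcases (tsupport η).eq_empty_or_nonempty with h | h
    · refine ⟨1/2, 1/2, by norm_num, by norm_num, fun x _ => ?_⟩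
      by_contra hx
      have := subset_tsupport _ (Function.mem_support.2 hx)
      simp [h] at this
    · obtain ⟨a, ha, ha'⟩ := hη.hasCompactSupport.exists_isLeast h
      obtain ⟨b, hb, hb'⟩ := hη.hasCompactSupport.exists_isGreatest h
      refine ⟨a, b, (hη.tsupport_subset ha).1, (hη.tsupport_subset hb).2, fun x hx => ?_⟩
      by_contra h0
      have := subset_tsupport _ (Function.mem_support.2 h0)
      exact hx ⟨ha' this, hb' this⟩
  have hz : ∀ x, x ∉ Icc a b → ∫ t in (0:ℝ)..x, η t = 0 := by
    intro x hx
    rcases lt_or_ge x a with h | h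
    · refine intervalIntegral.integral_zero_ae (Filter.Eventually.of_forall fun t ht => hab t ?_)
      intro ht'
      have := ht.2
      rcases le_max_iff.1 this with h1 | h1
      · linarith [ht'.1]
      · linarith [ht'.1]
    · have hb' : b < x := by
        by_contra h'; exact hx ⟨h, not_lt.1 h'⟩
      rw [← intervalIntegral.integral_add_adjacent_intervals (hc.intervalIntegrable 0 1)
        (hc.intervalIntegrable 1 x), h01, zero_add]
      refine intervalIntegral.integral_zero_ae (Filter.Eventually.of_forall fun t ht => hab t ?_)
      intro ht'
      have := ht.1
      rcases min_lt_iff.1 this with h1 | h1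
      · linarith [ht'.2]
      · linarith [ht'.2]
  have hs : tsupport (fun x => ∫ t in (0:ℝ)..x, η t) ⊆ Icc a b := by
    refine closure_minimal (fun x hx => ?_) isClosed_Icc
    by_contra h
    exact hx (hz x h)
  refine ⟨_, ⟨?_, ?_, ?_⟩, hde⟩
  · rw [contDiff_infty_iff_deriv]
    exact ⟨fun x => (hd x).differentiableAt, by rw [hde]; exact hη.contDiff⟩
  · exact isCompact_Icc.of_isClosed_subset isClosed_closure hs
  · exact hs.trans fun x hx => ⟨ha.trans_le hx.1, hx.2.trans_lt hb⟩

lemma exists_isTest_integral_eq_one : ∃ θ, IsTest θ ∧ ∫ x, θ x ∂μD = 1 := by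
  let f : ContDiffBump (1/2 : ℝ) := ⟨1/8, 1/4, by norm_num, by norm_num⟩
  have hs : tsupport (f.normed volume) ⊆ Ioo (0:ℝ) 1 := by
    rw [f.tsupport_normed_eq, Real.closedBall_eq_Icc]
    intro x hx
    have h1 : f.rOut = 1/4 := rfl
    rw [h1] at hx
    constructor <;> [linarith [hx.1]; linarith [hx.2]]
  refine ⟨f.normed volume, ⟨f.contDiff_normed, f.hasCompactSupport_normed, hs⟩, ?_⟩
  rw [setIntegral_eq_integral_of_forall_compl_eq_zero, f.integral_normed]
  intro x hx
  by_contra h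
  exact hx (hs (subset_tsupport _ (Function.mem_support.2 h)))

/-- A function with vanishing weak derivative is constant. -/
lemma ae_eq_const {f : ℝ → ℂ} (hf : Integrable f μD)
    (h : ∀ φ, IsTest φ → ∫ x, deriv φ x • f x ∂μD = 0) : ∃ c : ℂ, f =ᵐ[μD] fun _ => c := by
  obtain ⟨θ, hθ, hθ1⟩ := exists_isTest_integral_eq_one
  refine ⟨∫ x, θ x • f x ∂μD, ?_⟩
  set c := ∫ x, θ x • f x ∂μD with hc
  have hcI : Integrable (fun _ : ℝ => c) μD := integrable_const c
  have key := isOpen_Ioo.ae_eq_zero_of_integral_contDiff_smul_eq_zero (μ := μD)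
    (U := Ioo (0:ℝ) 1) (f := fun x => f x - c) ((hf.sub hcI).integrableOn.locallyIntegrableOn) ?_
  · have : ∀ᵐ x ∂μD, x ∈ Ioo (0:ℝ) 1 := ae_restrict_mem measurableSet_Ioo
    filter_upwards [key, this] with x hx hx'
    exact sub_eq_zero.1 (hx hx')
  · intro ψ h1 h2 h3
    have hψ : IsTest ψ := ⟨h1, h2, h3⟩
    set m := ∫ x, ψ x ∂μD with hm
    have hψI : Integrable ψ μD := h1.continuous.integrable_of_hasCompactSupport h2 |>.restrict
    have hθI : Integrable θ μD :=
      (hθ.contDiff.continuous.integrable_of_hasCompactSupport hθ.hasCompactSupport).restrict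
    have hη : IsTest (fun x => ψ x - m * θ x) := by
      refine ⟨h1.sub (contDiff_const.mul hθ.contDiff), ?_, ?_⟩
      · exact h2.sub hθ.hasCompactSupport.mul_left
      · refine (tsupport_sub _ _).trans (union_subset h3 ?_)
        exact (tsupport_mul_subset_right).trans hθ.tsupport_subset
    obtain ⟨φ, hφ, hφ'⟩ := hη.exists_primitive (by
      rw [integral_sub hψI (hθI.const_mul m), integral_const_mul, hθ1, ← hm]; ring)
    have h4 := h φ hφ
    rw [hφ'] at h4
    have h5 : ∫ x, ψ x • f x ∂μD = m • c := by
      have e : ∀ x, (ψ x - m * θ x) • f x = ψ x • f x - m • (θ x • f x) := fun x => by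
        rw [sub_smul, mul_smul]
      simp_rw [e] at h4
      rw [integral_sub (hψ.integrable_smul hf) (g := fun x => m • θ x • f x)
        ((hθ.integrable_smul hf).smul m), integral_smul] at h4
      exact sub_eq_zero.1 h4
    simp_rw [smul_sub]
    rw [integral_sub (hψ.integrable_smul hf) (hψ.integrable_smul hcI), h5, integral_smul_const, ← hm,
      sub_self]

lemma prim_congr {f g : ℝ → ℂ} (h : f =ᵐ[μD] g) : prim f = prim g := by
  funext x
  refine integral_congr_ae ?_
  filter_upwards [h] with t ht
  by_cases htx : t < x <;> simp [Set.indicator, htx, ht]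

lemma memLp_prim (v : L2) (p : ℝ≥0∞) : MemLp (prim v) p μD :=
  MemLp.of_bound (integrable_prim (integrable_L2 v)).aestronglyMeasurable ‖v‖
    (Filter.Eventually.of_forall (norm_prim_le v))

/-- The primitive as a bounded operator on `L²(0,1)`. -/
def primL : L2 →L[ℂ] L2 :=
  LinearMap.mkContinuous
    { toFun := fun v => (memLp_prim v 2).toLp
      map_add' := fun v w => by
        rw [← MemLp.toLp_add]
        refine MemLp.toLp_congr _ _ (Filter.Eventually.of_forall fun x => ?_)
        rw [prim_congr (Lp.coeFn_add v w)]
        simp only [prim, Pi.add_apply]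
        rw [Set.indicator_add']
        exact integral_add ((integrable_L2 v).indicator measurableSet_Iio)
          ((integrable_L2 w).indicator measurableSet_Iio)
      map_smul' := fun c v => by
        rw [RingHom.id_apply, ← MemLp.toLp_const_smul]
        refine MemLp.toLp_congr _ _ (Filter.Eventually.of_forall fun x => ?_)
        rw [prim_congr (Lp.coeFn_smul c v)]
        simp only [prim, Pi.smul_apply]
        rw [← integral_smul]
        refine integral_congr_ae (Filter.Eventually.of_forall fun t => ?_)
        exact congrFun (Set.indicator_const_smul (Iio x) c v) t } 1 (fun v => by
    have : IsProbabilityMeasure μD := ⟨by simp⟩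
    have h := Lp.norm_le_of_ae_bound (f := (memLp_prim v 2).toLp) (C := ‖v‖) (norm_nonneg _) (by
      filter_upwards [(memLp_prim v 2).coeFn_toLp] with x hx
      rw [hx]; exact norm_prim_le v x)
    simpa [measureUnivNNReal] using h)

lemma primL_ae (v : L2) : primL v =ᵐ[μD] prim v := (memLp_prim v 2).coeFn_toLp

/-- The constant function `1`. -/
def oneL : L2 := (memLp_const (1 : ℂ)).toLp (fun _ : ℝ => (1 : ℂ))

lemma oneL_ae : oneL =ᵐ[μD] fun _ => (1 : ℂ) := MemLp.coeFn_toLp _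

lemma IsTest.integral_deriv {φ : ℝ → ℝ} (hφ : IsTest φ) : ∫ x, deriv φ x ∂μD = 0 := by
  rw [← integral_Ioc_eq_integral_Ioo, ← intervalIntegral.integral_of_le zero_le_one,
    intervalIntegral.integral_deriv_eq_sub
      (fun x _ => (hφ.contDiff.differentiable (by simp)).differentiableAt)
      (hφ.isTest_deriv.contDiff.continuous.intervalIntegrable _ _),
    hφ.eq_zero (by simp), hφ.eq_zero (by simp), sub_zero]

lemma isWeakDeriv_iff (f g : L2) : IsWeakDeriv f g ↔ ∃ c : ℂ, f = primL g + c • oneL := by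
  have hp := integrable_prim (integrable_L2 g)
  constructor
  · intro h
    obtain ⟨c, hc⟩ := ae_eq_const ((integrable_L2 f).sub hp) (fun φ hφ => by
      have e : ∀ x, deriv φ x • (f x - prim g x) = deriv φ x • f x - deriv φ x • prim g x :=
        fun x => smul_sub _ _ _
      simp only [Pi.sub_apply]
      simp_rw [e]
      rw [integral_sub (hφ.isTest_deriv.integrable_smul (integrable_L2 f))
        (hφ.isTest_deriv.integrable_smul hp), h φ hφ,
        integral_deriv_smul_prim hφ (integrable_L2 g), sub_self])
    refine ⟨c, Lp.ext ?_⟩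
    filter_upwards [hc, primL_ae g, oneL_ae, Lp.coeFn_add (primL g) (c • oneL),
      Lp.coeFn_smul c oneL] with x h1 h2 h3 h4 h5
    simp only [Pi.sub_apply, Pi.add_apply, Pi.smul_apply] at h1 h4 h5
    rw [h4, h5, h2, h3, ← h1]
    simp
  · rintro ⟨c, rfl⟩ φ hφ
    rw [← integral_deriv_smul_prim hφ (integrable_L2 g)]
    have e : (fun x => deriv φ x • (primL g + c • oneL : L2) x) =ᵐ[μD]
        fun x => deriv φ x • prim g x + deriv φ x • c := by
      filter_upwards [primL_ae g, oneL_ae, Lp.coeFn_add (primL g) (c • oneL),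
        Lp.coeFn_smul c oneL] with x h2 h3 h4 h5
      simp only [Pi.add_apply, Pi.smul_apply] at h4 h5
      rw [h4, h5, h2, h3, ← smul_add]
      simp
    rw [integral_congr_ae e, integral_add (hφ.isTest_deriv.integrable_smul hp)
      (hφ.isTest_deriv.integrable_smul (integrable_const c)), integral_smul_const,
      hφ.integral_deriv, zero_smul, add_zero]

/-- The Sobolev space `H²(0,1)`: the functions `u ∈ L²` that have weak derivatives `u', u'' ∈ L²`.
Such a `u` is recorded as the pair `(u, u'')`, so the norm inherited from `L² × L²` is
`‖u‖²_{H²} = ‖u‖²_{L²} + ‖u''‖²_{L²}`. -/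
def H2 : Submodule ℂ (WithLp 2 (L2 × L2)) where
  carrier := {p | ∃ w : L2, IsWeakDeriv p.fst w ∧ IsWeakDeriv w p.snd}
  add_mem' := by
    rintro p p' ⟨w, h1, h2⟩ ⟨w', h1', h2'⟩
    rw [isWeakDeriv_iff] at h1 h2 h1' h2'
    obtain ⟨a, h1⟩ := h1
    obtain ⟨b, h2⟩ := h2
    obtain ⟨a', h1'⟩ := h1'
    obtain ⟨b', h2'⟩ := h2'
    refine ⟨w + w', (isWeakDeriv_iff _ _).2 ⟨a + a', ?_⟩, (isWeakDeriv_iff _ _).2 ⟨b + b', ?_⟩⟩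
    · rw [WithLp.add_fst, h1, h1', map_add, add_smul]; abel
    · rw [WithLp.add_snd, h2, h2', map_add, add_smul]; abel
  zero_mem' := ⟨0, (isWeakDeriv_iff _ _).2 ⟨0, by simp⟩, (isWeakDeriv_iff _ _).2 ⟨0, by simp⟩⟩
  smul_mem' := by
    rintro c p ⟨w, h1, h2⟩
    rw [isWeakDeriv_iff] at h1 h2
    obtain ⟨a, h1⟩ := h1
    obtain ⟨b, h2⟩ := h2
    refine ⟨c • w, (isWeakDeriv_iff _ _).2 ⟨c * a, ?_⟩, (isWeakDeriv_iff _ _).2 ⟨c * b, ?_⟩⟩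
    · rw [WithLp.smul_fst, h1, map_smul, smul_add, mul_smul]
    · rw [WithLp.smul_snd, h2, map_smul, smul_add, mul_smul]

lemma mem_H2_iff (p : WithLp 2 (L2 × L2)) : p ∈ H2 ↔
    ∃ a b : ℂ, p.fst = primL (primL p.snd + b • oneL) + a • oneL := by
  constructor
  · rintro ⟨w, h1, h2⟩
    obtain ⟨a, h1⟩ := (isWeakDeriv_iff _ _).1 h1
    obtain ⟨b, h2⟩ := (isWeakDeriv_iff _ _).1 h2
    exact ⟨a, b, by rw [h1, h2]⟩
  · rintro ⟨a, b, h⟩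
    exact ⟨_, (isWeakDeriv_iff _ _).2 ⟨a, h⟩, (isWeakDeriv_iff _ _).2 ⟨b, rfl⟩⟩

lemma isClosed_H2 : IsClosed (H2 : Set (WithLp 2 (L2 × L2))) := by
  let S : Submodule ℂ L2 := Submodule.span ℂ {oneL, primL oneL}
  have : FiniteDimensional ℂ S := FiniteDimensional.span_of_finite ℂ (Set.toFinite _)
  have hS : IsClosed (S : Set L2) := S.closed_of_finiteDimensional
  have hc : Continuous fun p : WithLp 2 (L2 × L2) => p.fst - primL (primL p.snd) := by fun_prop
  convert hS.preimage hc using 1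
  ext p
  simp only [SetLike.mem_coe, Set.mem_preimage, mem_H2_iff, S, Submodule.mem_span_pair]
  refine exists_congr fun a => exists_congr fun b => ?_
  rw [map_add, map_smul, eq_sub_iff_add_eq, eq_comm]
  constructor <;> intro h <;> rw [← h] <;> abel

instance : CompleteSpace H2 := isClosed_H2.completeSpace_coe

/-- The Hilbert space `X = H²(0,1) × L²(0,1)`, with `‖u‖²_X = ‖u₁‖²_{H²} + ‖u₂‖²_{L²}`. -/
abbrev X : Type := WithLp 2 (H2 × L2)

/-- The first component `u₁` of `u ∈ X`. -/
def X.fn₁ (u : X) : L2 := (u.fst : WithLp 2 (L2 × L2)).fst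

/-- The second weak derivative `u₁''` of the first component of `u ∈ X`. -/
def X.d2fn₁ (u : X) : L2 := (u.fst : WithLp 2 (L2 × L2)).snd

/-- The second component `u₂` of `u ∈ X`. -/
def X.fn₂ (u : X) : L2 := u.snd

/-- The form `𝒯(u, φ)` of the weak formulation. -/
def formT (χ₁ χ₂ q : Linf) (ω : ℂ) (u φ : X) : ℂ :=
  (∫ x, ((u.d2fn₁ x + ω ^ 2 * q x * u.fn₁ x) * conj (φ.fn₂ x)
      + χ₁ x * ω ^ 2 * u.fn₂ x * conj (u.fn₁ x) * conj (φ.fn₂ x)) ∂μD)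
  + ∫ x, (u.fn₂ x * (conj (φ.d2fn₁ x) + 4 * ω ^ 2 * q x * conj (φ.fn₁ x))
      + χ₂ x * ω ^ 2 * u.fn₁ x ^ 2 * conj (φ.fn₁ x)) ∂μD

lemma memLp_top_fn₁ (u : X) : MemLp u.fn₁ ∞ μD := by
  obtain ⟨w, h1, -⟩ := u.fst.2
  obtain ⟨c, h⟩ := (isWeakDeriv_iff _ _).1 h1
  refine ((memLp_prim w ∞).add (memLp_const c)).ae_eq ?_
  have h' : u.fn₁ = primL w + c • oneL := h
  rw [h']
  filter_upwards [primL_ae w, oneL_ae, Lp.coeFn_add (primL w) (c • oneL),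
    Lp.coeFn_smul c oneL] with x h2 h3 h4 h5
  simp only [Pi.add_apply, Pi.smul_apply] at h4 h5 ⊢
  rw [h4, h5, h2, h3]
  simp

lemma memLp_ofReal (χ : Linf) : MemLp (fun x => (χ x : ℂ)) ∞ μD := (Lp.memLp χ).ofReal

lemma memLp_bdd_mul {f g : ℝ → ℂ} (hf : MemLp f ∞ μD) (hg : MemLp g 2 μD) :
    MemLp (fun x => f x * g x) 2 μD := hg.mul hf

lemma integrable_mul_conj {f g : ℝ → ℂ} (hf : MemLp f 2 μD) (hg : MemLp g 2 μD) :
    Integrable (fun x => f x * conj (g x)) μD := MemLp.integrable_mul hf hg.star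

lemma inner_eq (f g : L2) : inner ℂ f g = ∫ x, g x * conj (f x) ∂μD := by
  rw [L2.inner_def]; rfl

/-- The Riesz representation of the form: `T_ω(u)` exists and is unique. -/
lemma existsUnique_riesz (χ₁ χ₂ q : Linf) (ω : ℂ) (u : X) :
    ∃! w : X, ∀ φ : X, formT χ₁ χ₂ q ω u φ = inner ℂ φ w := by
  have h1 := memLp_top_fn₁ u
  have h12 := Lp.memLp u.fn₁
  have h2 := Lp.memLp u.fn₂
  have hg : MemLp (fun x => (u.d2fn₁ x + ω ^ 2 * q x * u.fn₁ x)
      + χ₁ x * ω ^ 2 * u.fn₂ x * conj (u.fn₁ x)) 2 μD := by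
    have a := (memLp_bdd_mul (memLp_ofReal q) h12).const_mul (ω ^ 2)
    have b := (memLp_bdd_mul (memLp_ofReal χ₁) (memLp_bdd_mul h1.star h2)).const_mul (ω ^ 2)
    refine (((Lp.memLp u.d2fn₁).add a).add b).ae_eq (Filter.Eventually.of_forall fun x => ?_)
    simp only [Pi.add_apply, Pi.star_apply, RCLike.star_def]
    ring
  have hf : MemLp (fun x => 4 * ω ^ 2 * q x * u.fn₂ x + χ₂ x * ω ^ 2 * u.fn₁ x ^ 2) 2 μD := by
    have a := (memLp_bdd_mul (memLp_ofReal q) h2).const_mul (4 * ω ^ 2)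
    have b := (memLp_bdd_mul (memLp_ofReal χ₂) (memLp_bdd_mul h1 h12)).const_mul (ω ^ 2)
    refine (a.add b).ae_eq (Filter.Eventually.of_forall fun x => ?_)
    simp only [Pi.add_apply]
    ring
  let F : WithLp 2 (L2 × L2) := WithLp.toLp 2 (hf.toLp, u.fn₂)
  let w : X := WithLp.toLp 2 (H2.orthogonalProjectionOnto F, hg.toLp)
  have hw : ∀ φ : X, formT χ₁ χ₂ q ω u φ = inner ℂ φ w := by
    intro φ
    have hφ : inner ℂ φ w = inner ℂ φ.fn₁ hf.toLp + inner ℂ φ.d2fn₁ u.fn₂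
        + inner ℂ φ.fn₂ hg.toLp := by
      rw [WithLp.prod_inner_apply]
      congr 1
      change inner ℂ φ.fst (H2.orthogonalProjectionOnto F) = _
      rw [Submodule.inner_orthogonalProjectionOnto_eq_of_mem_left, WithLp.prod_inner_apply]
      rfl
    rw [hφ, inner_eq, inner_eq, inner_eq, formT, add_comm]
    have hp1 := Lp.memLp φ.fn₁
    congr 1
    · rw [← integral_add (integrable_mul_conj (Lp.memLp _) hp1)
        (integrable_mul_conj h2 (Lp.memLp _))]
      refine integral_congr_ae ?_
      filter_upwards [hf.coeFn_toLp] with x hx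
      rw [hx]
      ring
    · refine integral_congr_ae ?_
      filter_upwards [hg.coeFn_toLp] with x hx
      rw [hx]
      ring
  exact ⟨w, hw, fun w' hw' => ext_inner_left ℂ fun φ => by rw [← hw' φ, hw φ]⟩

/-- The nonlinear operator `T_ω : X → X`, defined by `𝒯(u, φ) = ⟨T_ω(u), φ⟩_X` for all `φ ∈ X`.
Mathlib's inner product is linear in its second argument, so `⟨a, b⟩_X` reads `inner ℂ b a`. -/
def opT (χ₁ χ₂ q : Linf) (ω : ℂ) (u : X) : X := (existsUnique_riesz χ₁ χ₂ q ω u).choose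

lemma formT_eq_inner (χ₁ χ₂ q : Linf) (ω : ℂ) (u φ : X) :
    formT χ₁ χ₂ q ω u φ = inner ℂ φ (opT χ₁ χ₂ q ω u) :=
  (existsUnique_riesz χ₁ χ₂ q ω u).choose_spec.1 φ

/-- The class `q` has a representative in `C¹[0,1]`. -/
def IsC1 (q : Linf) : Prop :=
  ∃ p : ℝ → ℝ, ContDiffOn ℝ 1 p (Icc (0 : ℝ) 1) ∧ q =ᵐ[μD] p

end

end SHG

open SHG

namespace SHG

open MeasureTheory Set
open scoped ComplexConjugate ENNReal

noncomputable section

/-! Write `w = |ω|²` and `u₁ = a + b x + r` with `|r| ≤ ‖u₁''‖`, and put `N = |a| + |b|`. If `T_ω(u)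
= 0`, three test functions give everything. Testing with `φ₂ = u₁''` makes `u₁''`, hence `r`, of
size `ε N` with `ε = w (‖q‖ + ‖χ₁‖ ‖u‖)`. Testing with `φ₁'' = u₂` makes `u₂` of size `w N²`.
Testing with affine `φ₁`, where `φ₁'' = 0`, removes the leading term; then `ω²` cancels and the
pairings of `χ₂ u₁²` with `1` and `x` are bounded by `4 ‖q‖ ‖u₂‖`.

Hence `∫ χ₂ (a + b x)² x^k` is `O((w + ε) N²)` for `k = 0, 1`. But positivity of `χ₂` bounds the sum
of the two moduli below by `c N²` (`exists_coercive`), even for complex `a, b`: the two quadratic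
forms have no common zero except the origin (`eq_zero_of_moments_eq_zero`). For small `w` and `ε`
this forces `N = 0`, and then `u = 0` (`eq_zero_of_opT_eq_zero`). The lower bound on `‖u‖` is the
contrapositive. -/

/-! ### Bounded multipliers and primitives in `L²(0,1)` -/

instance isProbabilityMeasure_μD : IsProbabilityMeasure μD := ⟨by simp⟩

/-- Multiplication of an `L²` function by a bounded function. -/
def mulL {k : ℝ → ℂ} (hk : MemLp k ∞ μD) (f : L2) : L2 := (memLp_bdd_mul hk (Lp.memLp f)).toLp

lemma mulL_ae {k : ℝ → ℂ} (hk : MemLp k ∞ μD) (f : L2) : mulL hk f =ᵐ[μD] fun x => k x * f x :=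
  MemLp.coeFn_toLp _

lemma norm_mulL_le {k : ℝ → ℂ} (hk : MemLp k ∞ μD) (f : L2) {K : ℝ}
    (hK : ∀ᵐ x ∂μD, ‖k x‖ ≤ K) : ‖mulL hk f‖ ≤ K * ‖f‖ := by
  refine Lp.norm_le_mul_norm_of_ae_le_mul ?_
  filter_upwards [mulL_ae hk f, hK] with x h1 h2
  rw [h1, norm_mul]
  gcongr

lemma norm_L2_le_of_ae_bound {f : L2} {C : ℝ} (hC : 0 ≤ C) (h : ∀ᵐ x ∂μD, ‖f x‖ ≤ C) :
    ‖f‖ ≤ C := by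
  simpa [measureUnivNNReal] using Lp.norm_le_of_ae_bound hC h

lemma ae_norm_le_norm (χ : Linf) : ∀ᵐ x ∂μD, ‖χ x‖ ≤ ‖χ‖ := by
  filter_upwards [enorm_ae_le_eLpNormEssSup χ μD] with x hx
  rw [Lp.norm_def, eLpNorm_exponent_top, ← toReal_enorm]
  refine ENNReal.toReal_mono ?_ hx
  rw [← eLpNorm_exponent_top]
  exact Lp.eLpNorm_ne_top χ

lemma norm_primL_le (v : L2) : ‖primL v‖ ≤ ‖v‖ :=
  norm_L2_le_of_ae_bound (norm_nonneg _) (by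
    filter_upwards [primL_ae v] with x hx
    rw [hx]; exact norm_prim_le v x)

lemma primL_oneL_ae : primL oneL =ᵐ[μD] fun x => (x : ℂ) := by
  filter_upwards [primL_ae oneL, ae_restrict_mem measurableSet_Ioo] with x hx hx'
  rw [hx, prim_congr oneL_ae, prim, integral_indicator measurableSet_Iio,
    Measure.restrict_restrict measurableSet_Iio]
  have e : Iio x ∩ Ioo 0 1 = Ioo 0 x := by
    ext t; simp only [mem_inter_iff, mem_Iio, mem_Ioo]
    exact ⟨fun h => ⟨h.2.1, h.1⟩, fun h => ⟨h.2, h.1, h.2.trans hx'.2⟩⟩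
  rw [e]
  simp [hx'.1.le]

lemma norm_oneL_le : ‖oneL‖ ≤ 1 :=
  norm_L2_le_of_ae_bound zero_le_one (by filter_upwards [oneL_ae] with x hx; simp [hx])

lemma memLp_mul_top {f g : ℝ → ℂ} (hf : MemLp f ∞ μD) (hg : MemLp g ∞ μD) :
    MemLp (fun x => f x * g x) ∞ μD := hg.mul hf

lemma memLp_top_conj {f : ℝ → ℂ} (hf : MemLp f ∞ μD) : MemLp (fun x => conj (f x)) ∞ μD := hf.star

/-! ### Test functions and the weak form -/

/-- The element of `X` with components `u₁` and `u₂`, where `u₁'' = p`,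
`u₁(0) = a` and `u₁'(0) = b`. -/
def mkX (p : L2) (a b : ℂ) (g : L2) : X :=
  WithLp.toLp 2 (⟨WithLp.toLp 2 (primL (primL p + b • oneL) + a • oneL, p),
    (mem_H2_iff _).2 ⟨a, b, rfl⟩⟩, g)

lemma fn₁_mkX (p : L2) (a b : ℂ) (g : L2) :
    (mkX p a b g).fn₁ = primL (primL p + b • oneL) + a • oneL := rfl

lemma d2fn₁_mkX (p : L2) (a b : ℂ) (g : L2) : (mkX p a b g).d2fn₁ = p := rfl

lemma fn₂_mkX (p : L2) (a b : ℂ) (g : L2) : (mkX p a b g).fn₂ = g := rfl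

lemma X.eq_zero {u : X} (h1 : u.fn₁ = 0) (h2 : u.d2fn₁ = 0) (h3 : u.fn₂ = 0) : u = 0 := by
  have e : u.fst = 0 := Subtype.ext (WithLp.ofLp_injective 2 (Prod.ext h1 h2))
  exact WithLp.ofLp_injective 2 (Prod.ext e h3)

lemma norm_fn₂_le (u : X) : ‖u.fn₂‖ ≤ ‖u‖ := WithLp.norm_snd_le _ u

/-- The nonlinear source term `χ f²` as an element of `L²`. -/
def sq (χ : Linf) {f : L2} (hf : MemLp f ∞ μD) : L2 :=
  mulL (memLp_mul_top (memLp_ofReal χ) hf) f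

lemma sq_ae (χ : Linf) {f : L2} (hf : MemLp f ∞ μD) :
    sq χ hf =ᵐ[μD] fun x => (χ x : ℂ) * f x ^ 2 := by
  filter_upwards [mulL_ae (memLp_mul_top (memLp_ofReal χ) hf) f] with x hx
  rw [sq, hx]; ring

/-- The weak form written with inner products in `L²`. -/
lemma formT_eq (χ₁ χ₂ q : Linf) (ω : ℂ) (u φ : X) :
    formT χ₁ χ₂ q ω u φ =
      inner ℂ φ.fn₂ (u.d2fn₁ + ω ^ 2 • (mulL (memLp_ofReal q) u.fn₁
        + mulL (memLp_mul_top (memLp_ofReal χ₁) (memLp_top_conj (memLp_top_fn₁ u))) u.fn₂))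
      + (inner ℂ φ.d2fn₁ u.fn₂
        + inner ℂ φ.fn₁ (ω ^ 2 • ((4 : ℂ) • mulL (memLp_ofReal q) u.fn₂
          + sq χ₂ (memLp_top_fn₁ u)))) := by
  rw [inner_eq, inner_eq, inner_eq, formT, ← integral_add
    (integrable_mul_conj (Lp.memLp _) (Lp.memLp _)) (integrable_mul_conj (Lp.memLp _) (Lp.memLp _))]
  congr 1
  · set A := mulL (memLp_ofReal q) u.fn₁ with hA
    set B := mulL (memLp_mul_top (memLp_ofReal χ₁) (memLp_top_conj (memLp_top_fn₁ u))) u.fn₂ with hB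
    refine integral_congr_ae ?_
    filter_upwards [mulL_ae (memLp_ofReal q) u.fn₁,
      mulL_ae (memLp_mul_top (memLp_ofReal χ₁) (memLp_top_conj (memLp_top_fn₁ u))) u.fn₂,
      Lp.coeFn_add u.d2fn₁ (ω ^ 2 • (A + B)), Lp.coeFn_smul (ω ^ 2) (A + B),
      Lp.coeFn_add A B] with x h1 h2 h3 h4 h5
    rw [h3, Pi.add_apply, h4, Pi.smul_apply, h5, Pi.add_apply, h1, h2, smul_eq_mul]
    ring
  · set A := mulL (memLp_ofReal q) u.fn₂ with hA
    set B := sq χ₂ (memLp_top_fn₁ u) with hB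
    refine integral_congr_ae ?_
    filter_upwards [mulL_ae (memLp_ofReal q) u.fn₂, sq_ae χ₂ (memLp_top_fn₁ u),
      Lp.coeFn_smul (ω ^ 2) ((4 : ℂ) • A + B), Lp.coeFn_add ((4 : ℂ) • A) B,
      Lp.coeFn_smul (4 : ℂ) A] with x h1 h2 h3 h4 h5
    rw [h3, Pi.smul_apply, h4, Pi.add_apply, h5, Pi.smul_apply, h1, h2, smul_eq_mul, smul_eq_mul]
    ring

/-! ### Moments of a positive weight and coercivity -/

/-- The moments of `χ`. -/
def moment (χ : Linf) (n : ℕ) : ℝ := ∫ x, χ x * x ^ n ∂μD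

lemma integrable_mul_of_continuous (χ : Linf) {p : ℝ → ℝ} (hp : Continuous p) :
    Integrable (fun x => χ x * p x) μD := by
  have h1 : Integrable χ μD := (Lp.memLp χ).integrable (by simp)
  obtain ⟨C, hC⟩ := isCompact_Icc.exists_bound_of_continuousOn (s := Icc (0:ℝ) 1) hp.continuousOn
  refine h1.mul_bdd (c := C) hp.aestronglyMeasurable ?_
  filter_upwards [ae_restrict_mem measurableSet_Ioo] with x hx
  exact hC x (Ioo_subset_Icc_self hx)

lemma integral_mul_affine_sq (χ : Linf) (a b : ℂ) (k : ℕ) :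
    ∫ x, (χ x : ℂ) * (a + b * x) ^ 2 * x ^ k ∂μD
      = moment χ k * a ^ 2 + 2 * moment χ (k + 1) * (a * b) + moment χ (k + 2) * b ^ 2 := by
  have hI (n : ℕ) : Integrable (fun x : ℝ => ((χ x * x ^ n : ℝ) : ℂ)) μD :=
    (integrable_mul_of_continuous χ (continuous_pow n)).ofReal
  have e (x : ℝ) : (χ x : ℂ) * (a + b * x) ^ 2 * x ^ k = ((χ x * x ^ k : ℝ) : ℂ) * a ^ 2
      + ((χ x * x ^ (k + 1) : ℝ) : ℂ) * (2 * (a * b)) + ((χ x * x ^ (k + 2) : ℝ) : ℂ) * b ^ 2 := by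
    push_cast; ring
  simp_rw [e]
  rw [integral_add (((hI _).mul_const _).fun_add ((hI _).mul_const _)) ((hI _).mul_const _),
    integral_add ((hI _).mul_const _) ((hI _).mul_const _), integral_mul_const,
    integral_mul_const, integral_mul_const, integral_complex_ofReal, integral_complex_ofReal,
    integral_complex_ofReal]
  simp only [moment]
  ring

/-- The form is `∫ χ (s + t x)²`; were it zero, almost every `x` would be the single root `-s / t`.
-/
lemma moment_quadratic_pos {χ : Linf} (hχ : ∀ᵐ x ∂μD, 0 < χ x) (s t : ℝ) (h : s ≠ 0 ∨ t ≠ 0) :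
    0 < moment χ 0 * s ^ 2 + 2 * moment χ 1 * (s * t) + moment χ 2 * t ^ 2 := by
  have hI (n : ℕ) := integrable_mul_of_continuous χ (continuous_pow n)
  have e : moment χ 0 * s ^ 2 + 2 * moment χ 1 * (s * t) + moment χ 2 * t ^ 2
      = ∫ x, χ x * (s + t * x) ^ 2 ∂μD := by
    have e (x : ℝ) : χ x * (s + t * x) ^ 2 = (χ x * x ^ 0) * s ^ 2
      + (χ x * x ^ 1) * (2 * (s * t)) + (χ x * x ^ 2) * t ^ 2 := by ring
    simp_rw [e]
    rw [integral_add (((hI 0).mul_const _).fun_add ((hI 1).mul_const _)) ((hI 2).mul_const _),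
      integral_add ((hI 0).mul_const _) ((hI 1).mul_const _), integral_mul_const,
      integral_mul_const, integral_mul_const]
    simp only [moment]
    ring
  have h0 : 0 ≤ᵐ[μD] fun x => χ x * (s + t * x) ^ 2 := by
    filter_upwards [hχ] with x hx
    exact mul_nonneg hx.le (sq_nonneg _)
  rw [e]
  refine (integral_nonneg_of_ae h0).lt_of_ne' fun hz => ?_
  rw [integral_eq_zero_iff_of_nonneg_ae h0 (integrable_mul_of_continuous χ (by fun_prop))] at hz
  have h1 : ∀ᵐ x ∂μD, x = -s / t := by
    filter_upwards [hz, hχ] with x h1 h2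
    have h3 : s + t * x = 0 := by
      have := (mul_eq_zero.1 h1).resolve_left h2.ne'
      exact pow_eq_zero_iff two_ne_zero |>.1 this
    have ht : t ≠ 0 := by
      rintro rfl
      simp_all
    field_simp
    linarith
  have h2 : ∀ᵐ x ∂μD, x ≠ -s / t := compl_mem_ae_iff.2 (measure_singleton _)
  obtain ⟨x, h3, h4⟩ := (h1.and h2).exists
  exact h4 h3

/-- If `b ≠ 0`, then `z = a / b` is a common root of two real quadratics. A real `z` contradicts
`hpos z 1` through the first equation alone. For non-real `z`, dividing the imaginary parts by `2 Im
z` gives `m₀ s + m₁ = 0` and `m₁ s + m₂ = 0` with `s = Re z`; adding `s` times the first to the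
second contradicts `hpos s 1`. -/
lemma eq_zero_of_moments_eq_zero {m₀ m₁ m₂ m₃ : ℝ}
    (hpos : ∀ s t : ℝ, s ≠ 0 ∨ t ≠ 0 → 0 < m₀ * s ^ 2 + 2 * m₁ * (s * t) + m₂ * t ^ 2) {a b : ℂ}
    (h1 : (m₀ : ℂ) * a ^ 2 + 2 * m₁ * (a * b) + m₂ * b ^ 2 = 0)
    (h2 : (m₁ : ℂ) * a ^ 2 + 2 * m₂ * (a * b) + m₃ * b ^ 2 = 0) : a = 0 ∧ b = 0 := by
  have hm₀ : 0 < m₀ := by simpa using hpos 1 0 (by simp)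
  by_cases hb : b = 0
  · subst hb
    simp [hm₀.ne'] at h1
    exact ⟨h1, rfl⟩
  exfalso
  obtain ⟨z, rfl⟩ : ∃ z, a = z * b := ⟨a / b, by field_simp⟩
  have hb2 : b ^ 2 ≠ 0 := pow_ne_zero 2 hb
  have e1 : (m₀ : ℂ) * z ^ 2 + 2 * m₁ * z + m₂ = 0 :=
    (mul_eq_zero.1 (by linear_combination h1 : _ * b ^ 2 = 0)).resolve_right hb2
  have e2 : (m₁ : ℂ) * z ^ 2 + 2 * m₂ * z + m₃ = 0 :=
    (mul_eq_zero.1 (by linear_combination h2 : _ * b ^ 2 = 0)).resolve_right hb2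
  have r1 := congrArg Complex.re e1
  have i1 := congrArg Complex.im e1
  have i2 := congrArg Complex.im e2
  simp [pow_two] at r1 i1 i2
  by_cases ht : z.im = 0
  · have := hpos z.re 1 (by simp)
    rw [ht] at r1
    nlinarith
  · have j1 : m₀ * z.re + m₁ = 0 := by
      apply mul_right_cancel₀ ht; linarith
    have j2 : m₁ * z.re + m₂ = 0 := by
      apply mul_right_cancel₀ ht; linarith
    have h3 := hpos z.re 1 (by simp)
    have h4 : m₀ * z.re ^ 2 + 2 * m₁ * (z.re * 1) + m₂ * 1 ^ 2 = 0 := by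
      linear_combination z.re * j1 + j2
    exact h3.ne' h4

/-- The two quadratic forms given by the moments of `χ` have no common isotropic vector. -/
lemma exists_coercive {χ : Linf} (hχ : ∀ᵐ x ∂μD, 0 < χ x) : ∃ c : ℝ, 0 < c ∧ ∀ a b : ℂ,
    c * (‖a‖ + ‖b‖) ^ 2 ≤ ‖∫ x, (χ x : ℂ) * (a + b * x) ^ 2 * x ^ 0 ∂μD‖
      + ‖∫ x, (χ x : ℂ) * (a + b * x) ^ 2 * x ^ 1 ∂μD‖ := by
  simp_rw [integral_mul_affine_sq]
  set F : ℂ × ℂ → ℝ := fun p => ‖(moment χ 0 : ℂ) * p.1 ^ 2 + 2 * moment χ (0 + 1) * (p.1 * p.2)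
    + moment χ (0 + 2) * p.2 ^ 2‖ + ‖(moment χ 1 : ℂ) * p.1 ^ 2
    + 2 * moment χ (1 + 1) * (p.1 * p.2) + moment χ (1 + 2) * p.2 ^ 2‖ with hF
  have hFc : Continuous F := by fun_prop
  -- `F` is continuous and `F (t v) = t² F v` for real `t`, so its minimum on the unit sphere
  -- controls it everywhere.
  obtain ⟨p, hp, hmin⟩ := (isCompact_sphere (0 : ℂ × ℂ) 1).exists_isMinOn
    (NormedSpace.sphere_nonempty.2 zero_le_one) hFc.continuousOn
  have hp0 : 0 < F p := by
    refine lt_of_le_of_ne (by positivity) fun h => ?_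
    obtain ⟨h1, h2⟩ := (add_eq_zero_iff_of_nonneg (norm_nonneg _) (norm_nonneg _)).1 h.symm
    obtain ⟨h3, h4⟩ := eq_zero_of_moments_eq_zero (moment_quadratic_pos hχ)
      (norm_eq_zero.1 h1) (norm_eq_zero.1 h2)
    have : p = 0 := Prod.ext h3 h4
    simp [this] at hp
  -- The norm on `ℂ × ℂ` is the maximum, so `(‖a‖ + ‖b‖)²` is at most `4` times its square.
  refine ⟨F p / 4, by positivity, fun a b => ?_⟩
  change _ ≤ F (a, b)
  set n := ‖(a, b)‖ with hn
  have hle : ‖a‖ + ‖b‖ ≤ 2 * n := by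
    have h1 : ‖a‖ ≤ n := norm_fst_le (a, b)
    have h2 : ‖b‖ ≤ n := norm_snd_le (a, b)
    linarith
  have hsq : (‖a‖ + ‖b‖) ^ 2 ≤ (2 * n) ^ 2 := by gcongr
  have key : F p * n ^ 2 ≤ F (a, b) := by
    rcases eq_or_ne n 0 with h | h
    · rw [h]; simp only [ne_eq, OfNat.ofNat_ne_zero, not_false_eq_true, zero_pow, mul_zero]
      positivity
    · have hnC : (n : ℂ) ≠ 0 := by exact_mod_cast h
      have h1 : F p ≤ F (a / n, b / n) := by
        refine hmin ?_
        have : ((a / n, b / n) : ℂ × ℂ) = (n : ℂ)⁻¹ • (a, b) := by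
          simp [div_eq_inv_mul]
        rw [this, mem_sphere_zero_iff_norm, norm_smul, norm_inv, Complex.norm_real, ← hn,
          norm_norm, inv_mul_cancel₀ h]
      have h2 : F (a, b) = F (a / n, b / n) * n ^ 2 := by
        have e (r s t : ℂ) : r * (a / n) ^ 2 + 2 * s * (a / n * (b / n)) + t * (b / n) ^ 2
            = (r * a ^ 2 + 2 * s * (a * b) + t * b ^ 2) / n ^ 2 := by field_simp
        simp only [hF, e, norm_div, norm_pow, Complex.norm_real]
        rw [Real.norm_eq_abs, sq_abs]
        field_simp
      rw [h2]
      gcongr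
  nlinarith

/-! ### A priori estimates for zeros of `T_ω` -/

/-- Cauchy–Schwarz gives `‖v‖² ≤ ‖v‖ ‖s‖`. It serves with `p = v` for `u₁''`, and with `p` the
double primitive of `v` for `u₂`. -/
lemma norm_le_of_inner_add_inner_eq_zero {v p s : L2} (hp : ‖p‖ ≤ ‖v‖)
    (h : inner ℂ v v + inner ℂ p s = 0) : ‖v‖ ≤ ‖s‖ := by
  have h1 : ‖v‖ * ‖v‖ ≤ ‖v‖ * ‖s‖ := by
    calc ‖v‖ * ‖v‖ = ‖inner ℂ v v‖ := by
          rw [inner_self_eq_norm_sq_to_K]; simp [pow_two]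
      _ = ‖inner ℂ p s‖ := by rw [eq_neg_of_add_eq_zero_left h, norm_neg]
      _ ≤ ‖p‖ * ‖s‖ := norm_inner_le_norm p s
      _ ≤ ‖v‖ * ‖s‖ := by gcongr
  rcases (norm_nonneg v).eq_or_lt with h0 | h0
  · rw [← h0]; exact norm_nonneg s
  · exact le_of_mul_le_mul_left h1 h0

section Zero

variable {χ₁ χ₂ q : Linf} {ω : ℂ} {u : X}

lemma formT_eq_zero (hT : opT χ₁ χ₂ q ω u = 0) (φ : X) : formT χ₁ χ₂ q ω u φ = 0 := by
  rw [formT_eq_inner, hT]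
  exact inner_zero_right (𝕜 := ℂ) φ

lemma norm_sq_le (χ : Linf) {f : L2} (hf : MemLp f ∞ μD) {B : ℝ}
    (h : ∀ᵐ x ∂μD, ‖f x‖ ≤ B) : ‖sq χ hf‖ ≤ ‖χ‖ * B ^ 2 := by
  refine norm_L2_le_of_ae_bound (by positivity) ?_
  filter_upwards [sq_ae χ hf, h, ae_norm_le_norm χ] with x h1 h2 h3
  rw [h1, norm_mul, norm_pow, Complex.norm_real]
  gcongr

/-- The test function `φ = (0, u₁'')` isolates the first equation. -/
lemma norm_d2fn₁_le (hT : opT χ₁ χ₂ q ω u = 0) {B : ℝ} (hB : 0 ≤ B)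
    (h : ∀ᵐ x ∂μD, ‖u.fn₁ x‖ ≤ B) :
    ‖u.d2fn₁‖ ≤ ‖ω‖ ^ 2 * (‖q‖ + ‖χ₁‖ * ‖u.fn₂‖) * B := by
  have h0 := formT_eq_zero hT (mkX 0 0 0 u.d2fn₁)
  rw [formT_eq, fn₁_mkX, d2fn₁_mkX, fn₂_mkX] at h0
  simp only [map_zero, zero_smul, add_zero, inner_zero_left, inner_add_right] at h0
  rw [← inner_add_right (𝕜 := ℂ) u.d2fn₁ u.d2fn₁ (_ : L2)] at h0
  have h1 := norm_le_of_inner_add_inner_eq_zero le_rfl (by rwa [inner_add_right] at h0)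
  refine h1.trans ?_
  rw [norm_smul, norm_pow, mul_assoc]
  gcongr
  refine (norm_add_le _ _).trans ?_
  rw [add_mul]
  have hk : ∀ᵐ x ∂μD, ‖(χ₁ x : ℂ) * conj (u.fn₁ x)‖ ≤ ‖χ₁‖ * B := by
    filter_upwards [ae_norm_le_norm χ₁, h] with x h2 h3
    rw [norm_mul, RCLike.norm_conj, Complex.norm_real]
    gcongr
  have hq : ∀ᵐ x ∂μD, ‖(q x : ℂ)‖ ≤ ‖q‖ := by
    filter_upwards [ae_norm_le_norm q] with x h2
    rwa [Complex.norm_real]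
  refine add_le_add ((norm_mulL_le _ _ hq).trans ?_) ((norm_mulL_le _ _ hk).trans_eq (by ring))
  gcongr
  exact norm_L2_le_of_ae_bound hB h

lemma norm_mulL_ofReal_le (χ : Linf) (f : L2) : ‖mulL (memLp_ofReal χ) f‖ ≤ ‖χ‖ * ‖f‖ := by
  refine norm_mulL_le _ _ ?_
  filter_upwards [ae_norm_le_norm χ] with x h2
  rwa [Complex.norm_real]

/-- The test function has `φ₁'' = u₂` with zero Cauchy data at `0`. It is admissible because `X`
imposes no boundary condition on `φ₁`. -/
lemma norm_fn₂_le_of_opT_eq_zero (hT : opT χ₁ χ₂ q ω u = 0) {B : ℝ}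
    (h : ∀ᵐ x ∂μD, ‖u.fn₁ x‖ ≤ B) :
    ‖u.fn₂‖ ≤ ‖ω‖ ^ 2 * (4 * (‖q‖ * ‖u.fn₂‖) + ‖χ₂‖ * B ^ 2) := by
  have h0 := formT_eq_zero hT (mkX u.fn₂ 0 0 0)
  rw [formT_eq, fn₁_mkX, d2fn₁_mkX, fn₂_mkX] at h0
  simp only [zero_smul, add_zero, zero_add, inner_zero_left] at h0
  refine (norm_le_of_inner_add_inner_eq_zero
    ((norm_primL_le _).trans (norm_primL_le _)) h0).trans ?_
  rw [norm_smul, norm_pow]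
  gcongr
  refine (norm_add_le _ _).trans (add_le_add ?_ (norm_sq_le χ₂ _ h))
  rw [norm_smul, Complex.norm_ofNat]
  gcongr
  exact norm_mulL_ofReal_le q u.fn₂

/-- Affine `φ₁` kills the term `u₂ φ₁''`, and every remaining term carries `ω²`, which divides out.
This is the solvability condition for `u₂` with `u₂ = u₂' = 0` at both ends. -/
lemma norm_inner_sq_le (hT : opT χ₁ χ₂ q ω u = 0) (hω : ω ≠ 0) (a b : ℂ)
    (hg : ‖primL (b • oneL) + a • oneL‖ ≤ 1) :
    ‖inner ℂ (primL (b • oneL) + a • oneL) (sq χ₂ (memLp_top_fn₁ u))‖ ≤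
      4 * (‖q‖ * ‖u.fn₂‖) := by
  have h0 := formT_eq_zero hT (mkX 0 a b 0)
  rw [formT_eq, fn₁_mkX, d2fn₁_mkX, fn₂_mkX] at h0
  simp only [map_zero, zero_add, inner_zero_left, inner_smul_right, mul_eq_zero, pow_eq_zero_iff,
    ne_eq, OfNat.ofNat_ne_zero, not_false_eq_true, hω, false_or] at h0
  rw [inner_add_right, inner_smul_right] at h0
  rw [eq_neg_of_add_eq_zero_right h0, norm_neg, norm_mul, Complex.norm_ofNat]
  gcongr
  refine (norm_inner_le_norm _ _).trans ?_
  calc _ ≤ 1 * (‖q‖ * ‖u.fn₂‖) := by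
        gcongr
        exact norm_mulL_ofReal_le q u.fn₂
    _ = _ := one_mul _

/-- Taylor expansion at `0`: the remainder is the double primitive of `u₁''`. -/
lemma ae_norm_sub_affine_le (u : X) : ∃ a b : ℂ,
    ∀ᵐ x : ℝ ∂μD, ‖u.fn₁ x - (a + b * (x : ℂ))‖ ≤ ‖u.d2fn₁‖ := by
  obtain ⟨a, b, h⟩ := (mem_H2_iff _).1 u.fst.2
  refine ⟨a, b, ?_⟩
  have h' : u.fn₁ = primL (primL u.d2fn₁) + (b • primL oneL + a • oneL) := by
    rw [← add_assoc, ← map_smul, ← map_add]; exact h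
  rw [h']
  filter_upwards [primL_ae (primL u.d2fn₁), primL_oneL_ae, oneL_ae,
    Lp.coeFn_add (primL (primL u.d2fn₁)) (b • primL oneL + a • oneL),
    Lp.coeFn_add (b • primL oneL) (a • oneL), Lp.coeFn_smul b (primL oneL),
    Lp.coeFn_smul a oneL] with x h1 h2 h3 h4 h5 h6 h7
  rw [h4, Pi.add_apply, h5, Pi.add_apply, h6, h7, Pi.smul_apply, Pi.smul_apply, h1, h2, h3,
    smul_eq_mul, smul_eq_mul, mul_one, add_comm a, add_sub_cancel_right]
  exact (norm_prim_le _ x).trans (norm_primL_le _)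

lemma ae_norm_affine_le (a b : ℂ) : ∀ᵐ x : ℝ ∂μD, ‖a + b * (x : ℂ)‖ ≤ ‖a‖ + ‖b‖ := by
  filter_upwards [ae_restrict_mem measurableSet_Ioo] with x hx
  refine (norm_add_le _ _).trans ?_
  rw [norm_mul, Complex.norm_real, Real.norm_of_nonneg hx.1.le]
  gcongr
  exact mul_le_of_le_one_right (norm_nonneg b) hx.2.le

/-- With `ℓ = a + b x`, the error comes from `f² - ℓ² = (f - ℓ)(2ℓ + (f - ℓ))` and `|x^k| ≤ 1`. -/
lemma norm_integral_mul_affine_sq_le (χ : Linf) {f : L2} (hf : MemLp f ∞ μD) {a b : ℂ} {D : ℝ}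
    (hD : 0 ≤ D) (h : ∀ᵐ x : ℝ ∂μD, ‖f x - (a + b * (x : ℂ))‖ ≤ D) {g : L2} {k : ℕ}
    (hg : g =ᵐ[μD] fun x : ℝ => (x : ℂ) ^ k) :
    ‖∫ x, (χ x : ℂ) * (a + b * x) ^ 2 * x ^ k ∂μD‖ ≤
      ‖inner ℂ g (sq χ hf)‖ + ‖χ‖ * (D * (2 * (‖a‖ + ‖b‖) + D)) := by
  have hI : Integrable (fun x : ℝ => (χ x : ℂ) * (a + b * x) ^ 2 * x ^ k) μD := by
    have hb : Integrable (fun x => (χ x : ℂ)) μD := (memLp_ofReal χ).integrable (by simp)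
    have hc : Continuous fun x : ℝ => (a + b * (x : ℂ)) ^ 2 * (x : ℂ) ^ k := by fun_prop
    refine (hb.mul_bdd (c := (‖a‖ + ‖b‖) ^ 2) hc.aestronglyMeasurable ?_).congr
      (Filter.Eventually.of_forall fun x => (mul_assoc _ _ _).symm)
    filter_upwards [ae_norm_affine_le a b, ae_restrict_mem measurableSet_Ioo] with x h1 h2
    rw [norm_mul, norm_pow, norm_pow, Complex.norm_real, Real.norm_of_nonneg h2.1.le]
    calc _ ≤ (‖a‖ + ‖b‖) ^ 2 * 1 := by
          gcongr
          · exact pow_nonneg h2.1.le k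
          · exact pow_le_one₀ h2.1.le h2.2.le
      _ = _ := mul_one _
  rw [← sub_le_iff_le_add', inner_eq]
  refine (norm_sub_norm_le _ _).trans ?_
  rw [← integral_sub hI (integrable_mul_conj (Lp.memLp _) (Lp.memLp _))]
  refine (norm_integral_le_of_norm_le_const (C := ‖χ‖ * (D * (2 * (‖a‖ + ‖b‖) + D))) ?_).trans
    (by simp)
  filter_upwards [h, hg, sq_ae χ hf, ae_norm_le_norm χ, ae_norm_affine_le a b,
    ae_restrict_mem measurableSet_Ioo] with x h1 h2 h3 h4 h5 h6
  rw [h2, h3, map_pow, Complex.conj_ofReal]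
  have e : (χ x : ℂ) * (a + b * x) ^ 2 * x ^ k - (χ x : ℂ) * f x ^ 2 * x ^ k
      = -((χ x : ℂ) * ((f x - (a + b * x)) * (2 * (a + b * x) + (f x - (a + b * x)))) * x ^ k) := by
    ring
  have h7 : ‖2 * (a + b * (x : ℂ)) + (f x - (a + b * x))‖ ≤ 2 * (‖a‖ + ‖b‖) + D := by
    refine (norm_add_le _ _).trans (add_le_add ?_ h1)
    rw [norm_mul, Complex.norm_ofNat]
    gcongr
  rw [e, norm_neg, norm_mul, norm_mul, norm_mul, norm_pow, Complex.norm_real, Complex.norm_real,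
    Real.norm_of_nonneg h6.1.le]
  calc _ ≤ ‖χ‖ * (D * (2 * (‖a‖ + ‖b‖) + D)) * 1 := by
        gcongr
        · exact pow_nonneg h6.1.le k
        · exact pow_le_one₀ h6.1.le h6.2.le
    _ = _ := mul_one _

/-! ### Triviality of solutions at small frequency -/

/-- If `c` is a coercivity constant for `χ₂`, then small frequencies admit only the trivial
solution. -/
lemma eq_zero_of_opT_eq_zero {c : ℝ} (hc : ∀ a b : ℂ,
      c * (‖a‖ + ‖b‖) ^ 2 ≤ ‖∫ x, (χ₂ x : ℂ) * (a + b * x) ^ 2 * x ^ 0 ∂μD‖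
        + ‖∫ x, (χ₂ x : ℂ) * (a + b * x) ^ 2 * x ^ 1 ∂μD‖)
    (hT : opT χ₁ χ₂ q ω u = 0) (hω : ω ≠ 0)
    (h1 : ‖ω‖ ^ 2 * (8 * ‖q‖) ≤ 1)
    (h2 : ‖ω‖ ^ 2 * (‖q‖ + ‖χ₁‖ * ‖u‖) ≤ 1 / 2)
    (h3 : ‖χ₂‖ * (64 * (‖q‖ * ‖ω‖ ^ 2)) + ‖χ₂‖ * (12 * (‖ω‖ ^ 2 * (‖q‖ + ‖χ₁‖ * ‖u‖))) < c) :
    u = 0 := by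
  obtain ⟨a, b, hab⟩ := ae_norm_sub_affine_le u
  set D := ‖u.d2fn₁‖ with hD
  set N := ‖a‖ + ‖b‖ with hN
  set w := ‖ω‖ ^ 2 with hw
  set ε := w * (‖q‖ + ‖χ₁‖ * ‖u‖) with hε
  have hD0 : 0 ≤ D := norm_nonneg _
  have hN0 : 0 ≤ N := by positivity
  have hw0 : 0 ≤ w := by positivity
  have hε0 : 0 ≤ ε := by positivity
  have hB : ∀ᵐ x ∂μD, ‖u.fn₁ x‖ ≤ N + D := by
    filter_upwards [hab, ae_norm_affine_le a b] with x h4 h5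
    calc ‖u.fn₁ x‖ = ‖(a + b * x) + (u.fn₁ x - (a + b * x))‖ := by rw [add_sub_cancel]
      _ ≤ N + D := (norm_add_le _ _).trans (add_le_add h5 h4)
  have hB0 : 0 ≤ N + D := by positivity
  have hDε : D ≤ ε * (N + D) := by
    refine (norm_d2fn₁_le hT hB0 hB).trans ?_
    rw [hε]
    gcongr
    exact norm_fn₂_le u
  -- Since `ε ≤ 1/2`, the term `ε D` is absorbed on the left.
  have hDN : D ≤ N := by nlinarith
  have hDN' : D ≤ 2 * ε * N := hDε.trans (by nlinarith)
  -- By `h1`, the term `4 w ‖q‖ ‖u₂‖` is at most half of `‖u₂‖`; absorbing it costs a factor `2`,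
  -- and `(N + D)² ≤ 4 N²`.
  have hu2 : ‖u.fn₂‖ ≤ 8 * w * ‖χ₂‖ * N ^ 2 := by
    have h4 := norm_fn₂_le_of_opT_eq_zero hT hB
    have h5 : w * (8 * ‖q‖) * ‖u.fn₂‖ ≤ 1 * ‖u.fn₂‖ := by gcongr
    have h6 : w * ‖χ₂‖ * (N + D) ^ 2 ≤ w * ‖χ₂‖ * (N + N) ^ 2 := by gcongr
    nlinarith
  have hquad (k : ℕ) {a' b' : ℂ} (hg : ‖primL (b' • oneL) + a' • oneL‖ ≤ 1)
      (hk : (primL (b' • oneL) + a' • oneL : L2) =ᵐ[μD] fun x : ℝ => (x : ℂ) ^ k) :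
      ‖∫ x, (χ₂ x : ℂ) * (a + b * x) ^ 2 * x ^ k ∂μD‖ ≤
        (‖χ₂‖ * (32 * (‖q‖ * w)) + ‖χ₂‖ * (6 * ε)) * N ^ 2 := by
    refine (norm_integral_mul_affine_sq_le χ₂ (memLp_top_fn₁ u) hD0 hab hk).trans ?_
    have h4 := norm_inner_sq_le hT hω a' b' hg
    have h5 : 4 * (‖q‖ * ‖u.fn₂‖) ≤ 4 * (‖q‖ * (8 * w * ‖χ₂‖ * N ^ 2)) := by gcongr
    have h6 : ‖χ₂‖ * (D * (2 * N + D)) ≤ ‖χ₂‖ * (2 * ε * N * (2 * N + N)) := by gcongr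
    calc _ ≤ 4 * (‖q‖ * (8 * w * ‖χ₂‖ * N ^ 2)) + ‖χ₂‖ * (2 * ε * N * (2 * N + N)) :=
          add_le_add (h4.trans h5) h6
      _ = _ := by ring
  have hq0 := hquad 0 (a' := 1) (b' := 0) (by simpa using norm_oneL_le)
    (by simpa using oneL_ae)
  have hq1 := hquad 1 (a' := 0) (b' := 1) (by simpa using (norm_primL_le _).trans norm_oneL_le)
    (by simpa using primL_oneL_ae)
  have hN2 : N ^ 2 = 0 := by
    -- Adding the bounds for `k = 0` and `k = 1` doubles `32` and `6` to the `64` and `12` of `h3`.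
    have := hc a b
    have h4 := sq_nonneg N
    by_contra h5
    have h6 : 0 < N ^ 2 := lt_of_le_of_ne h4 (Ne.symm h5)
    nlinarith [mul_lt_mul_of_pos_right h3 h6]
  have hN' : N = 0 := pow_eq_zero_iff two_ne_zero |>.1 hN2
  have hD' : D = 0 := le_antisymm (hDN.trans_eq hN') hD0
  refine X.eq_zero ?_ (norm_eq_zero.1 hD') ?_
  · refine norm_le_zero_iff.1 (norm_L2_le_of_ae_bound le_rfl ?_)
    simpa [hN', hD'] using hB
  · refine norm_le_zero_iff.1 (hu2.trans_eq ?_)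
    rw [hN2, mul_zero]

end Zero

/-! ### Choice of the constants -/

lemma norm_pos_of_ae_pos {χ : Linf} (hχ : ∀ᵐ x ∂μD, 0 < χ x) : 0 < ‖χ‖ := by
  obtain ⟨x, h1, h2⟩ := (hχ.and (ae_norm_le_norm χ)).exists
  exact h1.trans_le ((le_abs_self _).trans h2)

lemma exists_opT_ne_zero {Q : ℝ} (hQ : 0 < Q) {χ₂ : Linf} (hχ₂ : ∀ᵐ x ∂μD, 0 < χ₂ x) :
    ∃ c : ℝ, 0 < c ∧ ∀ χ₁ q : Linf, ‖q‖ = Q → ∀ (ω : ℂ) (u : X), u ≠ 0 → 0 < ‖ω‖ ^ 2 →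
      ‖ω‖ ^ 2 ≤ c / ((‖χ₁‖ + ‖χ₂‖) * (1 + (‖χ₁‖ + ‖χ₂‖) * ‖u‖)) →
      opT χ₁ χ₂ q ω u ≠ 0 := by
  obtain ⟨c₀, hc₀, hc⟩ := exists_coercive hχ₂
  have hm := norm_pos_of_ae_pos hχ₂
  set m := ‖χ₂‖ with hm'
  -- The three entries match the three smallness conditions of `eq_zero_of_opT_eq_zero`; the `2` in
  -- the last makes its inequality strict.
  refine ⟨min (m / (8 * Q)) (min (m / (2 * (Q + 1))) (c₀ / (2 * (64 * Q + 12 * (Q + 1))))),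
    by positivity, fun χ₁ q hq ω u hu hω hle hT => hu ?_⟩
  set c := min (m / (8 * Q)) (min (m / (2 * (Q + 1))) (c₀ / (2 * (64 * Q + 12 * (Q + 1)))))
  have hc1 : c * (8 * Q) ≤ m := (le_div_iff₀ (by positivity)).1 (min_le_left _ _)
  have hc2 : c * (2 * (Q + 1)) ≤ m :=
    (le_div_iff₀ (by positivity)).1 ((min_le_right _ _).trans (min_le_left _ _))
  have hc3 : c * (2 * (64 * Q + 12 * (Q + 1))) ≤ c₀ :=
    (le_div_iff₀ (by positivity)).1 ((min_le_right _ _).trans (min_le_right _ _))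
  set w := ‖ω‖ ^ 2 with hw
  set n := ‖u‖ with hn
  have hχ₁ : 0 ≤ ‖χ₁‖ := norm_nonneg χ₁
  have hn0 : 0 ≤ n := norm_nonneg u
  set M := ‖χ₁‖ + m with hM
  have hmM : m ≤ M := by linarith
  have hM0 : 0 < M := hm.trans_le hmM
  rw [le_div_iff₀ (by positivity)] at hle
  -- Bounds are kept multiplied by `m = ‖χ₂‖ ≤ M`, so that the constant involves neither `M` nor
  -- `χ₁`.
  have hwM : w * m ≤ c := by
    calc w * m ≤ w * (M * (1 + M * n)) := by
          gcongr
          calc m ≤ M * 1 := by linarith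
            _ ≤ _ := by gcongr; exact le_add_of_nonneg_right (by positivity)
      _ ≤ c := hle
  have hwn : w * (‖χ₁‖ * n) * m ≤ c := by
    calc w * (‖χ₁‖ * n) * m = w * (m * (‖χ₁‖ * n)) := by ring
      _ ≤ w * (M * (1 + M * n)) := by
          gcongr
          have : ‖χ₁‖ * n ≤ M * n := by gcongr; linarith
          linarith
      _ ≤ c := hle
  have hε : w * (Q + ‖χ₁‖ * n) * m ≤ c * (Q + 1) := by
    have := mul_le_mul_of_nonneg_right hwM hQ.le
    linarith
  refine eq_zero_of_opT_eq_zero (c := c₀) hc hT ?_ ?_ ?_ ?_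
  · rintro rfl
    simp [hw] at hω
  · rw [hq]
    refine le_of_mul_le_mul_right ?_ hm
    have := mul_le_mul_of_nonneg_right hwM hQ.le
    linarith
  · rw [hq]
    refine le_of_mul_le_mul_right ?_ hm
    linarith
  · rw [hq]
    have := mul_le_mul_of_nonneg_right hwM hQ.le
    linarith

end

end SHG

theorem theorem1 (Q : ℝ) (hQ : 0 < Q) (χ₂ : Linf) (hχ₂ : ∀ᵐ x ∂μD, 0 < χ₂ x) :
    (∃ c : ℝ, 0 < c ∧ ∀ χ₁ q : Linf, IsC1 q → ‖q‖ = Q → ∀ (ω : ℂ) (u : X), u ≠ 0 →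
      0 < ‖ω‖ ^ 2 →
      ‖ω‖ ^ 2 ≤ c / ((‖χ₁‖ + ‖χ₂‖) * (1 + (‖χ₁‖ + ‖χ₂‖) * ‖u‖)) →
      opT χ₁ χ₂ q ω u ≠ 0) ∧
    (∀ M : ℝ, ∃ δ c : ℝ, 0 < δ ∧ 0 < c ∧ ∀ χ₁ q : Linf, ‖χ₁‖ + ‖χ₂‖ = M → IsC1 q → ‖q‖ = Q →
      ∀ (ω : ℂ) (u : X), u ≠ 0 → 0 < ‖ω‖ → ‖ω‖ ≤ δ → opT χ₁ χ₂ q ω u = 0 →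
      c / ‖ω‖ ^ 2 ≤ ‖u‖) := by
  obtain ⟨c, hc, h⟩ := exists_opT_ne_zero hQ hχ₂
  refine ⟨⟨c, hc, fun χ₁ q _ => h χ₁ q⟩, fun M => ?_⟩
  rcases le_or_gt M 0 with hM | hM
  -- This case is vacuous, since `‖χ₂‖ > 0`.
  · refine ⟨1, 1, one_pos, one_pos, fun χ₁ q hχ => ?_⟩
    linarith [norm_pos_of_ae_pos hχ₂, norm_nonneg χ₁]
  -- A nonzero solution has `c < |ω|² (M + M² ‖u‖)`. This `δ` makes `|ω|² M ≤ c / 2`, so the term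
  -- with `‖u‖` exceeds `c / 2`.
  refine ⟨Real.sqrt (c / (2 * M)), c / (2 * M ^ 2), by positivity, by positivity,
    fun χ₁ q hχ _ hq ω u hu hω hδ hT => ?_⟩
  have hω2 : 0 < ‖ω‖ ^ 2 := by positivity
  have h1 : ‖ω‖ ^ 2 * (2 * M) ≤ c := by
    rw [← le_div_iff₀ (by positivity)]
    exact (Real.le_sqrt' hω).1 hδ
  have h2 : c < ‖ω‖ ^ 2 * (M * (1 + M * ‖u‖)) := by
    by_contra hcon
    refine h χ₁ q hq ω u hu hω2 ?_ hT
    rw [hχ, le_div_iff₀ (by positivity)]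
    exact not_lt.1 hcon
  rw [div_div, div_le_iff₀ (by positivity)]
  linarith
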